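/- Let $m\ge 1$, let $\mathcal M$ be the algebra of complex $m\times m$ matrices and let $H,X\in\mathcal M$ be Hermitian. Let $\|X\|$ be the operator norm. For $n\ge1$ and $A\in\mathcal M$ put $$A^{(n)}=\frac1n(A_1+\dots+A_n)\in\mathcal M^{\otimes n},\qquad A_k=1\otimes\dots\otimes A\otimes\dots\otimes 1\ \ (A\text{ in the }k\text{-th factor}).$$ For $s\in\mathbb R$ let $C(s)=\ln\operatorname{Tr}e^{-H+sX}-\ln\operatorname{Tr}e^{-H}$, and let $I(u)=\sup_{s\in\mathbb R}[su-C(s)]$ be its Legendre transform; it takes values in $[0,+\infty]$ on $[-\|X\|,\|X\|]$. Then for every continuous function $f:[-\|X\|,\|X\|]\to\mathbb R$, with $f(X^{(n)})$ given by the functional calculus, the number $\sup_{u\in[-\|X\|,\|X\|]}[f(u)-I(u)]$ is finite and $$\lim_{n\to\infty}\frac1n\ln\operatorname{Tr}e^{n[f(X^{(n)})-H^{(n)}]}=\sup_{u\in[-\|X\|,\|X\|]}[f(u)-I(u)]+\ln\operatorname{Tr}e^{-H}.$$ -/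

import Mathlib

open Filter Topology

noncomputable section

namespace QLD

/-- The elementary tensor `A 0 ⊗ A 1 ⊗ ⋯ ⊗ A (n-1)` of complex `m × m` matrices (the `n`-fold
Kronecker product), in the algebra `M^{⊗n}` realised as the matrices acting on `(ℂ^m)^{⊗n}`,
whose standard basis is indexed by the functions `Fin n → Fin m`. -/
def tensorProd {m n : ℕ} (A : Fin n → Matrix (Fin m) (Fin m) ℂ) :
    Matrix (Fin n → Fin m) (Fin n → Fin m) ℂ :=
  Matrix.of fun σ τ => ∏ k, A k (σ k) (τ k)

/-- `X_k = 1 ⊗ ⋯ ⊗ X ⊗ ⋯ ⊗ 1`, the copy of `X` in the `k`-th tensor factor. -/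
def siteCopy {m : ℕ} (n : ℕ) (X : Matrix (Fin m) (Fin m) ℂ) (k : Fin n) :
    Matrix (Fin n → Fin m) (Fin n → Fin m) ℂ :=
  tensorProd (Function.update (fun _ => 1) k X)

/-- The mean-field average `X^{(n)} = (X_1 + ⋯ + X_n) / n`. -/
def meanField {m : ℕ} (n : ℕ) (X : Matrix (Fin m) (Fin m) ℂ) :
    Matrix (Fin n → Fin m) (Fin n → Fin m) ℂ :=
  (n : ℝ)⁻¹ • ∑ k : Fin n, siteCopy n X k

/-- `ln Tr e^A`, for a Hermitian matrix `A` (so that the trace is real). -/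
def logTrExp {ι : Type*} [Fintype ι] [DecidableEq ι] (A : Matrix ι ι ℂ) : ℝ :=
  Real.log (Matrix.trace (NormedSpace.exp A)).re

/-- The cumulant generating function `C(s) = ln Tr e^{-H + s X} - ln Tr e^{-H}`. -/
def cumulant {m : ℕ} (H X : Matrix (Fin m) (Fin m) ℂ) (s : ℝ) : ℝ :=
  logTrExp (-H + s • X) - logTrExp (-H)

/-- The Legendre transform `u ↦ sup_s (s u - C(s))`, with values in the extended reals. -/
def legendre (C : ℝ → ℝ) (u : ℝ) : EReal :=
  ⨆ s : ℝ, ((s * u - C s : ℝ) : EReal)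

/-- The rate function: the Legendre transform of the cumulant generating function. -/
def rate {m : ℕ} (H X : Matrix (Fin m) (Fin m) ℂ) : ℝ → EReal :=
  legendre (cumulant H X)

end QLD

end

open scoped Matrix.Norms.L2Operator

/-! If `f` is affine, `f t = c + s * t`, the exponent is a sum of commuting one-site operators, the
trace factorises, and the limit is `c + logTrExp (-H + s • X)`. A general `f` is compared with
affine functions locally, and the upper and lower bounds use different mechanisms.

Upper bound. By definition of the Legendre transform, each `u` admits a slope `s` with `f u - s * u
+ logTrExp (-H + s • X)` below any level exceeding the claimed limit. Near `u`, `f` lies below an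
affine function of slope `s`, up to a small error. Finitely many such neighbourhoods cover the
spectral interval, and a quadratic partition of unity in `X^(n)` glues the affine bounds. Localising
`H^(n)` costs only commutators with continuous functions of `X^(n)`, which tend to zero
(`tendsto_commutator_cfc`). The operator Jensen-type inequality `trace_exp_le_sum` then bounds the
trace by a sum of boundedly many factorised traces, whose number disappears after `(1/n) ln`.

Lower bound. The Gibbs variational principle `logTrExp_add_gibbs_le` is applied to the product state
of the tilted Hamiltonian `H - s X`. In that state `X^(n)` concentrates at the one-site mean, so `f
(X^(n))` may be replaced by `f` of that mean (`eventually_gt_of_gibbs`). When `I(u)` is finite,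
`exists_subgradient_eq` yields a tilt with mean as close to `u` as desired, even if no tilt attains
`u` exactly. -/

namespace QLD

/-! ### Convexity inequalities for the trace of an exponential -/

section TraceInequalities

open scoped MatrixOrder ComplexOrder Matrix

variable {ι : Type*} [Fintype ι]

/-- The real part of a diagonal entry is monotone after conjugation. -/
theorem re_diag_conj_mono {A B : Matrix ι ι ℂ} (h : A ≤ B) (W : Matrix ι ι ℂ) (i : ι) :
    ((Wᴴ * A * W) i i).re ≤ ((Wᴴ * B * W) i i).re := by
  have h1 := (Matrix.le_iff.1 h).conjTranspose_mul_mul_same W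
  have h2 := h1.diag_nonneg (i := i)
  have h3 : Wᴴ * (B - A) * W = Wᴴ * B * W - Wᴴ * A * W := by
    rw [Matrix.mul_sub, Matrix.sub_mul]
  rw [h3, Matrix.sub_apply] at h2
  have := (Complex.le_def.1 h2).1
  simpa using this

theorem re_trace_mono {A B : Matrix ι ι ℂ} (h : A ≤ B) : A.trace.re ≤ B.trace.re := by
  have := (Matrix.le_iff.1 h).trace_nonneg
  rw [Matrix.trace_sub] at this
  simpa using (Complex.le_def.1 this).1

variable [DecidableEq ι]

/-- Every function is continuous on the real spectrum of a matrix,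
because that spectrum is finite. -/
theorem continuousOn_spectrum {A : Matrix ι ι ℂ} (g : ℝ → ℝ) :
    ContinuousOn g (spectrum ℝ A) := by
  have : (spectrum ℝ A).Finite := Matrix.finite_real_spectrum
  rw [continuousOn_iff_continuous_domRestrict]
  have := this.to_subtype
  exact continuous_of_discreteTopology

theorem exp_eq_cfc {A : Matrix ι ι ℂ} (hA : A.IsHermitian) :
    NormedSpace.exp A = cfc Real.exp A :=
  (CFC.real_exp_eq_normedSpace_exp (a := A) hA.isSelfAdjoint).symm

theorem exp_nonneg {A : Matrix ι ι ℂ} (hA : A.IsHermitian) : 0 ≤ NormedSpace.exp A := by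
  rw [exp_eq_cfc hA]
  exact cfc_nonneg fun x _ => (Real.exp_pos x).le

/-- The tangent line inequality for the exponential, as a matrix inequality. -/
theorem tangent_le_exp {A : Matrix ι ι ℂ} (hA : A.IsHermitian) (c : ℝ) :
    (Real.exp c * (1 - c)) • (1 : Matrix ι ι ℂ) + Real.exp c • A ≤ NormedSpace.exp A := by
  rw [exp_eq_cfc hA]
  have h1 : (Real.exp c * (1 - c)) • (1 : Matrix ι ι ℂ) + Real.exp c • A
      = cfc (fun x : ℝ => Real.exp c * (1 - c) + Real.exp c * x) A := by
    rw [cfc_const_add _ _ A (continuousOn_spectrum _) hA.isSelfAdjoint,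
      cfc_const_mul_id _ A hA.isSelfAdjoint, Algebra.algebraMap_eq_smul_one]
  rw [h1]
  refine cfc_mono (fun x _ => ?_) (continuousOn_spectrum _) (continuousOn_spectrum _)
  have h2 := Real.add_one_le_exp (x - c)
  have h3 : Real.exp x = Real.exp c * Real.exp (x - c) := by rw [← Real.exp_add]; ring_nf
  rw [h3]
  nlinarith [Real.exp_pos c]

/-- Factor `D = R* R`; by cyclicity both traces become traces of conjugates by `R`, and conjugation
preserves the order. -/
theorem re_trace_mul_mono {A B D : Matrix ι ι ℂ} (hD : 0 ≤ D) (h : A ≤ B) :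
    (D * A).trace.re ≤ (D * B).trace.re := by
  obtain ⟨R, rfl⟩ := CStarAlgebra.nonneg_iff_eq_star_mul_self.1 hD
  have h1 := (Matrix.le_iff.1 h).mul_mul_conjTranspose_same R
  have h2 : R * A * Rᴴ ≤ R * B * Rᴴ := by
    rw [Matrix.le_iff]
    convert h1 using 1
    rw [Matrix.mul_sub, Matrix.sub_mul]
  have h3 := re_trace_mono h2
  have key (M : Matrix ι ι ℂ) : (star R * R * M).trace = (R * M * Rᴴ).trace := by
    rw [Matrix.star_eq_conjTranspose, Matrix.mul_assoc, Matrix.trace_mul_comm]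
  rwa [key, key]

/-- Diagonalisation of a Hermitian matrix and of its exponential. -/
theorem exists_diagonalization {A : Matrix ι ι ℂ} (hA : A.IsHermitian) :
    ∃ (U : Matrix ι ι ℂ) (a : ι → ℝ), Uᴴ * U = 1 ∧ U * Uᴴ = 1 ∧
      Uᴴ * A * U = Matrix.diagonal (fun i => (a i : ℂ)) ∧
      Uᴴ * NormedSpace.exp A * U = Matrix.diagonal (fun i => (Real.exp (a i) : ℂ)) := by
  have hU1 : (hA.eigenvectorUnitary : Matrix ι ι ℂ)ᴴ * hA.eigenvectorUnitary = 1 :=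
    Unitary.coe_star_mul_self hA.eigenvectorUnitary
  have hU2 : (hA.eigenvectorUnitary : Matrix ι ι ℂ) * (hA.eigenvectorUnitary : Matrix ι ι ℂ)ᴴ = 1 :=
    Unitary.coe_mul_star_self hA.eigenvectorUnitary
  have key (g : ℝ → ℝ) : (hA.eigenvectorUnitary : Matrix ι ι ℂ)ᴴ * cfc g A *
      hA.eigenvectorUnitary = Matrix.diagonal (fun i => (g (hA.eigenvalues i) : ℂ)) := by
    rw [hA.cfc_eq, Matrix.IsHermitian.cfc, Unitary.conjStarAlgAut_apply]
    rw [← Matrix.mul_assoc, ← Matrix.mul_assoc, hU1, Matrix.one_mul, Matrix.mul_assoc]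
    erw [hU1]
    rw [Matrix.mul_one]
    rfl
  refine ⟨hA.eigenvectorUnitary, hA.eigenvalues, hU1, hU2, ?_, ?_⟩
  · have := key id
    rwa [cfc_id ℝ A hA.isSelfAdjoint] at this
  · rw [exp_eq_cfc hA, key]

theorem trace_conj_unitary {U : Matrix ι ι ℂ} (hU : U * Uᴴ = 1) (M : Matrix ι ι ℂ) :
    (Uᴴ * M * U).trace = M.trace := by
  rw [Matrix.trace_mul_comm, ← Matrix.mul_assoc, hU, Matrix.one_mul]

/-- If `A` is bounded by a "noncommutative convex combination" of the `B j`, then `Tr e^A` is at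
most the sum of the `Tr e^{B j}`. -/
theorem trace_exp_le_sum {J : Type*} [Fintype J] {A : Matrix ι ι ℂ} (hA : A.IsHermitian)
    (χ B : J → Matrix ι ι ℂ) (hχ : ∀ j, (χ j).IsHermitian) (hB : ∀ j, (B j).IsHermitian)
    (h1 : ∑ j, χ j * χ j = 1) (h2 : A ≤ ∑ j, χ j * B j * χ j) :
    (NormedSpace.exp A).trace.re ≤ ∑ j, (NormedSpace.exp (B j)).trace.re := by
  obtain ⟨U, a, hU1, hU2, hUA, hUE⟩ := exists_diagonalization hA
  have step (i : ι) : Real.exp (a i) ≤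
      ∑ j, ((Uᴴ * (χ j * NormedSpace.exp (B j) * χ j) * U) i i).re := by
    -- Jensen's inequality at the `i`-th eigenvector of `A`: its images under the `χ j` have squared
    -- norms summing to 1, and `c` is the resulting mean of the `B j`. The tangent to the
    -- exponential at `c` has its linear part cancel on summation.
    set c : ℝ := ∑ j, ((Uᴴ * (χ j * B j * χ j) * U) i i).re with hc
    have hac : a i ≤ c := by
      have := re_diag_conj_mono h2 U i
      rw [hUA, Matrix.diagonal_apply_eq, Matrix.mul_sum, Matrix.sum_mul, Matrix.sum_apply,
        Complex.re_sum] at this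
      simpa using this
    have hone : ∑ j, ((Uᴴ * (χ j * χ j) * U) i i).re = 1 := by
      rw [← Complex.re_sum, ← Matrix.sum_apply, ← Matrix.sum_mul, ← Matrix.mul_sum, h1,
        Matrix.mul_one, hU1]
      simp
    refine (Real.exp_le_exp.2 hac).trans ?_
    have hterm (j : J) : Real.exp c * (1 - c) * ((Uᴴ * (χ j * χ j) * U) i i).re
        + Real.exp c * ((Uᴴ * (χ j * B j * χ j) * U) i i).re
        ≤ ((Uᴴ * (χ j * NormedSpace.exp (B j) * χ j) * U) i i).re := by
      have := re_diag_conj_mono (tangent_le_exp (hB j) c) (χ j * U) i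
      have conj (M : Matrix ι ι ℂ) : (χ j * U)ᴴ * M * (χ j * U) = Uᴴ * (χ j * M * χ j) * U := by
        rw [Matrix.conjTranspose_mul, (hχ j).eq]
        simp only [Matrix.mul_assoc]
      rw [conj, conj] at this
      refine le_trans (le_of_eq ?_) this
      simp [Matrix.mul_add, Matrix.add_mul, Complex.exp_ofReal_re]
    have := Finset.sum_le_sum fun j (_ : j ∈ Finset.univ) => hterm j
    rw [Finset.sum_add_distrib, ← Finset.mul_sum, ← Finset.mul_sum, hone, ← hc] at this
    linarith
  have h3 : (NormedSpace.exp A).trace.re = ∑ i, Real.exp (a i) := by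
    rw [← trace_conj_unitary hU2, hUE, Matrix.trace_diagonal, Complex.re_sum]
    simp only [Complex.ofReal_re]
  have h4 : ∑ i, ∑ j, ((Uᴴ * (χ j * NormedSpace.exp (B j) * χ j) * U) i i).re
      = ∑ j, (χ j * NormedSpace.exp (B j) * χ j).trace.re := by
    rw [Finset.sum_comm]
    refine Finset.sum_congr rfl fun j _ => ?_
    rw [← trace_conj_unitary hU2, Matrix.trace, Complex.re_sum]
    rfl
  rw [h3]
  refine (Finset.sum_le_sum fun i _ => step i).trans ?_
  rw [h4]
  refine Finset.sum_le_sum fun j _ => ?_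
  -- By cyclicity the `j`-th term is the trace of `e^{B j}` against `χ j ^ 2`, so this removes the
  -- cutoff.
  have h5 : χ j * χ j ≤ 1 := by
    rw [← h1]
    refine Finset.single_le_sum (f := fun k => χ k * χ k) (fun k _ => ?_) (Finset.mem_univ j)
    have := star_mul_self_nonneg (χ k)
    rwa [(hχ k).isSelfAdjoint.star_eq] at this
  have h6 := re_trace_mul_mono (exp_nonneg (hB j)) h5
  rwa [Matrix.mul_one, ← Matrix.mul_assoc, Matrix.trace_mul_comm, ← Matrix.mul_assoc] at h6

theorem trace_exp_re_pos [Nonempty ι] {A : Matrix ι ι ℂ} (hA : A.IsHermitian) :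
    0 < (NormedSpace.exp A).trace.re := by
  obtain ⟨U, a, hU1, hU2, hUA, hUE⟩ := exists_diagonalization hA
  rw [← trace_conj_unitary hU2, hUE, Matrix.trace_diagonal, Complex.re_sum]
  simp only [Complex.ofReal_re]
  exact Finset.sum_pos (fun i _ => Real.exp_pos _) Finset.univ_nonempty

/-- The expectation of `M` in the Gibbs state `e^A / Tr e^A`. -/
noncomputable def gibbs (A M : Matrix ι ι ℂ) : ℝ :=
  (NormedSpace.exp A * M).trace.re / (NormedSpace.exp A).trace.re

/-- The Gibbs variational principle (Peierls–Bogoliubov inequality). -/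
theorem logTrExp_add_gibbs_le [Nonempty ι] {A B : Matrix ι ι ℂ} (hA : A.IsHermitian)
    (hB : B.IsHermitian) : logTrExp A + gibbs A (B - A) ≤ logTrExp B := by
  obtain ⟨U, a, hU1, hU2, hUA, hUE⟩ := exists_diagonalization hA
  set b : ι → ℝ := fun i => ((Uᴴ * B * U) i i).re with hb
  have htr : (NormedSpace.exp A).trace.re = ∑ i, Real.exp (a i) := by
    rw [← trace_conj_unitary hU2, hUE, Matrix.trace_diagonal, Complex.re_sum]
    simp only [Complex.ofReal_re]
  have hpos := trace_exp_re_pos hA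
  have hmul : (NormedSpace.exp A * (B - A)).trace.re = ∑ i, Real.exp (a i) * (b i - a i) := by
    have : Uᴴ * (NormedSpace.exp A * (B - A)) * U
        = Matrix.diagonal (fun i => (Real.exp (a i) : ℂ)) *
          (Uᴴ * B * U - Matrix.diagonal (fun i => (a i : ℂ))) := by
      rw [← hUE, ← hUA]
      calc _ = Uᴴ * NormedSpace.exp A * 1 * (B - A) * U := by
            simp only [Matrix.mul_assoc, Matrix.one_mul]
        _ = _ := by
          rw [← hU2]
          simp only [Matrix.mul_assoc, Matrix.mul_sub, Matrix.sub_mul]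
    rw [← trace_conj_unitary hU2, this, Matrix.trace, Complex.re_sum]
    refine Finset.sum_congr rfl fun i _ => ?_
    rw [Matrix.diag_apply, Matrix.diagonal_mul, Matrix.sub_apply, Matrix.diagonal_apply_eq,
      Complex.re_ofReal_mul, Complex.sub_re, Complex.ofReal_re]
  -- Peierls' inequality in the eigenbasis of `A`: use the tangent at each diagonal entry `b i`.
  have hBge : ∑ i, Real.exp (b i) ≤ (NormedSpace.exp B).trace.re := by
    rw [← trace_conj_unitary hU2 (NormedSpace.exp B), Matrix.trace, Complex.re_sum]
    refine Finset.sum_le_sum fun i _ => ?_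
    have := re_diag_conj_mono (tangent_le_exp hB (b i)) U i
    refine le_trans (le_of_eq ?_) this
    simp [Matrix.mul_add, Matrix.add_mul, hU1, hb, Complex.exp_ofReal_re]
    ring
  set c : ℝ := gibbs A (B - A) with hc
  have hcmul : c * ∑ i, Real.exp (a i) = ∑ i, Real.exp (a i) * (b i - a i) := by
    rw [hc, gibbs, hmul, htr, div_mul_cancel₀]
    rw [← htr]; exact hpos.ne'
  -- Scalar Jensen for `b - a` under the weights `e^{a i}`, whose mean is `c`.
  have key : Real.exp c * ∑ i, Real.exp (a i) ≤ ∑ i, Real.exp (b i) := by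
    have hterm (i : ι) : Real.exp c * (Real.exp (a i) * (1 - c) + Real.exp (a i) * (b i - a i))
        ≤ Real.exp (b i) := by
      have h1 := Real.add_one_le_exp (b i - a i - c)
      have h2 : Real.exp (b i) = Real.exp c * Real.exp (a i) * Real.exp (b i - a i - c) := by
        rw [← Real.exp_add, ← Real.exp_add]; ring_nf
      rw [h2]
      nlinarith [mul_pos (Real.exp_pos c) (Real.exp_pos (a i))]
    have := Finset.sum_le_sum fun i (_ : i ∈ Finset.univ) => hterm i
    rw [← Finset.mul_sum, Finset.sum_add_distrib, ← Finset.sum_mul, ← hcmul] at this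
    refine le_trans (le_of_eq ?_) this
    ring
  have : Real.exp c * (NormedSpace.exp A).trace.re ≤ (NormedSpace.exp B).trace.re := by
    rw [htr]; exact key.trans hBge
  have h := Real.log_le_log (mul_pos (Real.exp_pos c) hpos) this
  rw [Real.log_mul (Real.exp_pos c).ne' hpos.ne', Real.log_exp] at h
  unfold logTrExp
  linarith

end TraceInequalities

/-! ### Mean-field observables and product states on tensor powers -/

section TensorPowers

open scoped Matrix

variable {m n : ℕ}

theorem tensorProd_mul (A B : Fin n → Matrix (Fin m) (Fin m) ℂ) :
    tensorProd A * tensorProd B = tensorProd (fun k => A k * B k) := by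
  ext σ τ
  simp only [tensorProd, Matrix.mul_apply, Matrix.of_apply, Finset.prod_univ_sum,
    Fintype.piFinset_univ, Finset.prod_mul_distrib]

theorem trace_tensorProd (A : Fin n → Matrix (Fin m) (Fin m) ℂ) :
    (tensorProd A).trace = ∏ k, (A k).trace := by
  simp only [tensorProd, Matrix.trace, Matrix.diag_apply, Matrix.of_apply, Finset.prod_univ_sum,
    Fintype.piFinset_univ]

theorem tensorProd_one : tensorProd (fun _ : Fin n => (1 : Matrix (Fin m) (Fin m) ℂ)) = 1 := by
  ext σ τ
  simp only [tensorProd, Matrix.of_apply, Matrix.one_apply, Finset.prod_ite_zero,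
    Finset.mem_univ, true_implies, Finset.prod_const_one, funext_iff]

theorem tensorProd_conjTranspose (A : Fin n → Matrix (Fin m) (Fin m) ℂ) :
    (tensorProd A)ᴴ = tensorProd (fun k => (A k)ᴴ) := by
  ext σ τ
  simp [tensorProd, Matrix.conjTranspose_apply]

theorem siteCopy_apply (A : Matrix (Fin m) (Fin m) ℂ) (k : Fin n) (σ τ : Fin n → Fin m) :
    siteCopy n A k σ τ = A (σ k) (τ k) *
      ∏ l ∈ Finset.univ.erase k, (1 : Matrix (Fin m) (Fin m) ℂ) (σ l) (τ l) := by
  rw [siteCopy, tensorProd, Matrix.of_apply, ← Finset.mul_prod_erase _ _ (Finset.mem_univ k),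
    Function.update_self]
  congr 1
  refine Finset.prod_congr rfl fun l hl => ?_
  rw [Function.update_of_ne (Finset.ne_of_mem_erase hl)]

/-- The inclusion of a tensor factor, as a star algebra homomorphism. -/
noncomputable def siteHom (n : ℕ) (k : Fin n) :
    Matrix (Fin m) (Fin m) ℂ →⋆ₐ[ℂ] Matrix (Fin n → Fin m) (Fin n → Fin m) ℂ where
  toFun A := siteCopy n A k
  map_one' := by
    rw [siteCopy, Function.update_eq_self_iff.2 rfl, tensorProd_one]
  map_mul' A B := by
    rw [siteCopy, siteCopy, siteCopy, tensorProd_mul]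
    congr 1
    ext1 l
    by_cases h : l = k
    · subst h; simp
    · simp [Function.update_of_ne h]
  map_zero' := by
    ext σ τ
    simp [siteCopy_apply]
  map_add' A B := by
    ext σ τ
    simp [siteCopy_apply, add_mul]
  commutes' r := by
    have h1 : siteCopy n (1 : Matrix (Fin m) (Fin m) ℂ) k = 1 := by
      rw [siteCopy, Function.update_eq_self_iff.2 rfl, tensorProd_one]
    rw [Algebra.algebraMap_eq_smul_one, Algebra.algebraMap_eq_smul_one, ← h1]
    ext σ τ
    simp only [siteCopy_apply, Matrix.smul_apply, smul_eq_mul, mul_assoc]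
  map_star' A := by
    rw [siteCopy, siteCopy, Matrix.star_eq_conjTranspose, Matrix.star_eq_conjTranspose,
      tensorProd_conjTranspose]
    congr 1
    ext1 l
    by_cases h : l = k
    · subst h; simp
    · simp [Function.update_of_ne h]

theorem siteHom_apply (A : Matrix (Fin m) (Fin m) ℂ) (k : Fin n) :
    siteHom n k A = siteCopy n A k := rfl

theorem siteCopy_commute (A B : Matrix (Fin m) (Fin m) ℂ) {k l : Fin n} (h : k ≠ l) :
    Commute (siteCopy n A k) (siteCopy n B l) := by
  unfold Commute SemiconjBy siteCopy
  rw [tensorProd_mul, tensorProd_mul]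
  congr 1
  ext1 j
  by_cases hk : j = k
  · subst hk; simp [Function.update_of_ne h]
  · simp [Function.update_of_ne hk]

theorem norm_siteCopy_le (A : Matrix (Fin m) (Fin m) ℂ) (k : Fin n) : ‖siteCopy n A k‖ ≤ ‖A‖ :=
  NonUnitalStarAlgHom.norm_apply_le (siteHom n k) A

theorem exp_siteCopy (A : Matrix (Fin m) (Fin m) ℂ) (k : Fin n) :
    NormedSpace.exp (siteCopy n A k) = siteCopy n (NormedSpace.exp A) k := by
  have hc : Continuous (siteHom (m := m) n k) :=
    LinearMap.continuous_of_finiteDimensional (siteHom (m := m) n k).toAlgHom.toLinearMap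
  let _ : NormedAlgebra ℚ (Matrix (Fin m) (Fin m) ℂ) := .restrictScalars ℚ ℂ _
  exact (NormedSpace.map_exp (siteHom (m := m) n k) hc A).symm

theorem exp_sum_siteCopy (A : Matrix (Fin m) (Fin m) ℂ) :
    NormedSpace.exp (∑ k : Fin n, siteCopy n A k) = tensorProd (fun _ => NormedSpace.exp A) := by
  have key (s : Finset (Fin n)) : NormedSpace.exp (∑ k ∈ s, siteCopy n A k)
      = tensorProd (fun k => if k ∈ s then NormedSpace.exp A else 1) := by
    induction s using Finset.induction_on with
    | empty => simp [tensorProd_one]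
    | insert k s hk ih =>
      rw [Finset.sum_insert hk, Matrix.exp_add_of_commute, ih, exp_siteCopy, siteCopy,
        tensorProd_mul]
      · congr 1
        ext1 l
        by_cases h : l = k
        · subst h; simp [hk]
        · simp [h]
      · refine Commute.sum_right _ _ _ fun l hl => siteCopy_commute A A ?_
        rintro rfl
        exact hk hl
  simpa using key Finset.univ

theorem smul_meanField (hn : n ≠ 0) (A : Matrix (Fin m) (Fin m) ℂ) :
    (n : ℝ) • meanField n A = ∑ k : Fin n, siteCopy n A k := by
  rw [meanField, smul_inv_smul₀ (Nat.cast_ne_zero.2 hn)]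

theorem meanField_eq_siteHom (A : Matrix (Fin m) (Fin m) ℂ) :
    meanField n A = (n : ℝ)⁻¹ • ∑ k : Fin n, siteHom n k A := rfl

theorem meanField_add (A B : Matrix (Fin m) (Fin m) ℂ) :
    meanField n (A + B) = meanField n A + meanField n B := by
  simp only [meanField_eq_siteHom, map_add, Finset.sum_add_distrib, smul_add]

theorem meanField_neg (A : Matrix (Fin m) (Fin m) ℂ) :
    meanField n (-A) = -meanField n A := by
  simp only [meanField_eq_siteHom, map_neg, Finset.sum_neg_distrib, smul_neg]

theorem meanField_sub (A B : Matrix (Fin m) (Fin m) ℂ) :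
    meanField n (A - B) = meanField n A - meanField n B := by
  rw [sub_eq_add_neg, meanField_add, meanField_neg, sub_eq_add_neg]

theorem meanField_smul (r : ℝ) (A : Matrix (Fin m) (Fin m) ℂ) :
    meanField n (r • A) = r • meanField n A := by
  have h (k : Fin n) : siteHom n k (r • A) = r • siteHom n k A := by
    have := map_smul (siteHom n k) (r : ℂ) A
    simpa only [Complex.coe_smul] using this
  simp only [meanField_eq_siteHom, h, ← Finset.smul_sum]
  rw [smul_comm]

theorem meanField_one (hn : n ≠ 0) : meanField n (1 : Matrix (Fin m) (Fin m) ℂ) = 1 := by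
  simp only [meanField_eq_siteHom, map_one, Finset.sum_const, Finset.card_univ, Fintype.card_fin]
  rw [← Nat.cast_smul_eq_nsmul ℝ, inv_smul_smul₀ (Nat.cast_ne_zero.2 hn)]

theorem isHermitian_sum_siteCopy {A : Matrix (Fin m) (Fin m) ℂ} (hA : A.IsHermitian) :
    (∑ k : Fin n, siteCopy n A k).IsHermitian := by
  refine Matrix.isHermitian_iff_isSelfAdjoint.2 (isSelfAdjoint_sum _ fun k _ => ?_)
  exact hA.isSelfAdjoint.map (siteHom n k)

theorem isHermitian_meanField {A : Matrix (Fin m) (Fin m) ℂ} (hA : A.IsHermitian) :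
    (meanField n A).IsHermitian :=
  (IsSelfAdjoint.all (n : ℝ)⁻¹).smul (isHermitian_sum_siteCopy hA).isSelfAdjoint

theorem norm_meanField_le (A : Matrix (Fin m) (Fin m) ℂ) : ‖meanField n A‖ ≤ ‖A‖ := by
  rw [meanField, norm_smul, norm_inv, Real.norm_natCast]
  have h : ‖∑ k : Fin n, siteCopy n A k‖ ≤ n * ‖A‖ := by
    refine (norm_sum_le _ _).trans ?_
    refine (Finset.sum_le_sum fun k _ => norm_siteCopy_le A k).trans ?_
    simp
  rcases Nat.eq_zero_or_pos n with rfl | hn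
  · simp
  · rw [inv_mul_le_iff₀ (by exact_mod_cast hn)]
    exact h

/-- Mean-field observables commute asymptotically. -/
theorem meanField_commutator (A B : Matrix (Fin m) (Fin m) ℂ) :
    meanField n A * meanField n B - meanField n B * meanField n A
      = (n : ℝ)⁻¹ • meanField n (A * B - B * A) := by
  simp only [meanField, smul_mul_smul_comm, ← smul_sub, smul_smul]
  congr 1
  rw [Finset.sum_mul_sum, Finset.sum_mul_sum, Finset.sum_comm (f := fun i j => siteCopy n B i * _),
    ← Finset.sum_sub_distrib]
  refine Finset.sum_congr rfl fun k _ => ?_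
  -- Distinct sites commute, so only `n` of the `n ^ 2` commutators survive; this is the source of
  -- the factor `1/n`.
  rw [← Finset.sum_sub_distrib, Finset.sum_eq_single k]
  · simp only [← siteHom_apply, map_sub, map_mul]
  · intro l _ hl
    rw [(siteCopy_commute A B hl.symm).eq, sub_self]
  · simp

theorem norm_meanField_commutator_le (A B : Matrix (Fin m) (Fin m) ℂ) :
    ‖meanField n A * meanField n B - meanField n B * meanField n A‖
      ≤ (n : ℝ)⁻¹ * ‖A * B - B * A‖ := by
  rw [meanField_commutator, norm_smul, norm_inv, Real.norm_natCast]
  gcongr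
  exact norm_meanField_le _

/-- Adjunction reverses the product and cyclicity restores it. Reality of one-site traces allows
real parts to pass through the products of traces below. -/
theorem trace_mul_eq_re {ι : Type*} [Fintype ι] {A B : Matrix ι ι ℂ}
    (hA : A.IsHermitian) (hB : B.IsHermitian) : (A * B).trace = ((A * B).trace.re : ℂ) := by
  have h : star (A * B).trace = (A * B).trace := by
    rw [← Matrix.trace_conjTranspose, Matrix.conjTranspose_mul, hA.eq, hB.eq, Matrix.trace_mul_comm]
  exact (Complex.conj_eq_iff_re.1 h).symm

theorem trace_tensorProd_update (E Z : Matrix (Fin m) (Fin m) ℂ) (k : Fin n) :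
    (tensorProd (Function.update (fun _ => E) k Z)).trace = Z.trace * E.trace ^ (n - 1) := by
  rw [trace_tensorProd, ← Finset.mul_prod_erase _ _ (Finset.mem_univ k), Function.update_self]
  congr 1
  rw [Finset.prod_congr rfl (g := fun _ => E.trace), Finset.prod_const,
    Finset.card_erase_of_mem (Finset.mem_univ k), Finset.card_univ, Fintype.card_fin]
  intro l hl
  rw [Function.update_of_ne (Finset.ne_of_mem_erase hl)]

theorem tensorProd_const_mul_siteCopy (E Z : Matrix (Fin m) (Fin m) ℂ) (k : Fin n) :
    tensorProd (fun _ => E) * siteCopy n Z k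
      = tensorProd (Function.update (fun _ => E) k (E * Z)) := by
  rw [siteCopy, tensorProd_mul]
  congr 1
  ext1 l
  by_cases h : l = k
  · subst h; simp
  · simp [Function.update_of_ne h]

theorem logTrExp_sum_siteCopy (hm : 0 < m) {K : Matrix (Fin m) (Fin m) ℂ} (hK : K.IsHermitian) :
    logTrExp (∑ k : Fin n, siteCopy n K k) = n * logTrExp K := by
  have : Nonempty (Fin m) := ⟨⟨0, hm⟩⟩
  have hre : (NormedSpace.exp K).trace = ((NormedSpace.exp K).trace.re : ℂ) := by
    simpa using trace_mul_eq_re hK.exp Matrix.isHermitian_one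
  rw [logTrExp, logTrExp, exp_sum_siteCopy, trace_tensorProd, Finset.prod_const, Finset.card_univ,
    Fintype.card_fin, hre, ← Complex.ofReal_pow, Complex.ofReal_re, Complex.ofReal_re, Real.log_pow]

theorem gibbs_sum_siteCopy_meanField (hm : 0 < m) (hn : n ≠ 0) {K M : Matrix (Fin m) (Fin m) ℂ}
    (hK : K.IsHermitian) :
    gibbs (∑ k : Fin n, siteCopy n K k) (meanField n M) = gibbs K M := by
  have : Nonempty (Fin m) := ⟨⟨0, hm⟩⟩
  have hpos := trace_exp_re_pos hK
  have hre : (NormedSpace.exp K).trace = ((NormedSpace.exp K).trace.re : ℂ) := by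
    simpa using trace_mul_eq_re hK.exp Matrix.isHermitian_one
  obtain ⟨j, rfl⟩ := Nat.exists_eq_succ_of_ne_zero hn
  rw [gibbs, gibbs, exp_sum_siteCopy, meanField, trace_tensorProd, Matrix.mul_smul, Matrix.mul_sum,
    Matrix.trace_smul, Matrix.trace_sum]
  simp only [tensorProd_const_mul_siteCopy, trace_tensorProd_update, Finset.sum_const,
    Finset.prod_const, Finset.card_univ, Fintype.card_fin]
  rw [hre, ← Complex.ofReal_pow, ← Complex.ofReal_pow]
  simp only [Complex.ofReal_re, Complex.smul_re, Complex.re_mul_ofReal, nsmul_eq_mul, smul_eq_mul,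
    Nat.succ_sub_one, ← Complex.ofReal_natCast, Complex.re_ofReal_mul]
  rw [Nat.succ_eq_add_one, pow_succ]
  have : ((j + 1 : ℕ) : ℝ) ≠ 0 := by positivity
  field_simp

/-- The variance of a centred mean-field observable in a product Gibbs state. -/
theorem gibbs_sum_siteCopy_meanField_sq (hm : 0 < m) (hn : n ≠ 0)
    {K Y : Matrix (Fin m) (Fin m) ℂ} (hK : K.IsHermitian) (hY : Y.IsHermitian)
    (h0 : gibbs K Y = 0) :
    gibbs (∑ k : Fin n, siteCopy n K k) (meanField n Y * meanField n Y)
      = (n : ℝ)⁻¹ * gibbs K (Y * Y) := by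
  have : Nonempty (Fin m) := ⟨⟨0, hm⟩⟩
  have hpos := trace_exp_re_pos hK
  have hre : (NormedSpace.exp K).trace = ((NormedSpace.exp K).trace.re : ℂ) := by
    simpa using trace_mul_eq_re hK.exp Matrix.isHermitian_one
  have hY0 : (NormedSpace.exp K * Y).trace = 0 := by
    rw [trace_mul_eq_re hK.exp hY]
    rw [gibbs, div_eq_zero_iff] at h0
    rw [h0.resolve_right hpos.ne', Complex.ofReal_zero]
  obtain ⟨j, rfl⟩ := Nat.exists_eq_succ_of_ne_zero hn
  set E := NormedSpace.exp K with hE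
  -- Independence of distinct sites: the factor at `l` is the centred one-site trace, which
  -- vanishes.
  have hoff (k l : Fin j.succ) (hkl : l ≠ k) :
      (tensorProd (fun _ => E) * (siteCopy j.succ Y k * siteCopy j.succ Y l)).trace = 0 := by
    rw [← Matrix.mul_assoc, tensorProd_const_mul_siteCopy, siteCopy, tensorProd_mul,
      trace_tensorProd]
    refine Finset.prod_eq_zero (Finset.mem_univ l) ?_
    rw [Function.update_of_ne hkl, Function.update_self, hY0]
  have hdiag (k : Fin j.succ) :
      (tensorProd (fun _ => E) * (siteCopy j.succ Y k * siteCopy j.succ Y k)).trace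
        = (E * (Y * Y)).trace * E.trace ^ j := by
    rw [← siteHom_apply, ← map_mul, siteHom_apply, tensorProd_const_mul_siteCopy,
      trace_tensorProd_update, Nat.succ_sub_one]
  have htr : (tensorProd (fun _ : Fin j.succ => E) * (meanField j.succ Y * meanField j.succ Y)).trace
      = ((((j.succ : ℕ) : ℝ)⁻¹ * ((j.succ : ℕ) : ℝ)⁻¹ * (j.succ : ℕ) : ℝ) : ℂ) *
        ((E * (Y * Y)).trace * E.trace ^ j) := by
    rw [meanField, smul_mul_smul_comm, Finset.sum_mul_sum, Matrix.mul_smul, Matrix.trace_smul,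
      Matrix.mul_sum, Matrix.trace_sum]
    rw [Finset.sum_congr rfl (g := fun _ => (E * (Y * Y)).trace * E.trace ^ j)]
    · rw [Finset.sum_const, Finset.card_univ, Fintype.card_fin, nsmul_eq_mul, Complex.real_smul]
      push_cast
      ring
    · intro k _
      rw [Matrix.mul_sum, Matrix.trace_sum, Finset.sum_eq_single k (fun l _ hl => hoff k l hl)
        (by simp), hdiag]
  rw [gibbs, gibbs, exp_sum_siteCopy, htr, trace_tensorProd, Finset.prod_const, Finset.card_univ,
    Fintype.card_fin, hre, ← Complex.ofReal_pow, ← Complex.ofReal_pow, Complex.re_ofReal_mul,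
    Complex.re_mul_ofReal, Nat.succ_eq_add_one, pow_succ, ← hE]
  simp only [Complex.ofReal_re]
  have : ((j + 1 : ℕ) : ℝ) ≠ 0 := by positivity
  field_simp

end TensorPowers

/-! ### Asymptotic commutation, localisation and the upper bound -/

section UpperBound

open scoped MatrixOrder ComplexOrder Matrix

theorem abs_le_norm_of_mem_spectrum {ι : Type*} [Fintype ι] [DecidableEq ι] [Nonempty ι]
    {A : Matrix ι ι ℂ} {x : ℝ} (hx : x ∈ spectrum ℝ A) : |x| ≤ ‖A‖ := by
  simpa using spectrum.norm_le_norm_of_mem hx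

variable {m n : ℕ}

theorem spectrum_meanField_subset (hm : 0 < m) (X : Matrix (Fin m) (Fin m) ℂ) :
    spectrum ℝ (meanField n X) ⊆ Set.Icc (-‖X‖) ‖X‖ := by
  have : Nonempty (Fin m) := ⟨⟨0, hm⟩⟩
  intro x hx
  exact abs_le.1 ((abs_le_norm_of_mem_spectrum hx).trans (norm_meanField_le X))

theorem norm_commutator_mul_le {R : Type*} [NormedRing R] (p x h : R) :
    ‖p * x * h - h * (p * x)‖ ≤ ‖p * h - h * p‖ * ‖x‖ + ‖p‖ * ‖x * h - h * x‖ := by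
  have hid : p * x * h - h * (p * x) = (p * h - h * p) * x + p * (x * h - h * x) := by
    noncomm_ring
  rw [hid]
  exact (norm_add_le _ _).trans (add_le_add (norm_mul_le _ _) (norm_mul_le _ _))

theorem norm_aeval_monomial_le {R : Type*} [NormedRing R] [NormedAlgebra ℝ R] [NormOneClass R]
    {x : R} {r : ℝ} (hx : ‖x‖ ≤ r) (a : ℝ) (k : ℕ) :
    ‖Polynomial.aeval x (Polynomial.C a * Polynomial.X ^ k)‖ ≤ |a| * r ^ k := by
  rw [map_mul, Polynomial.aeval_C, map_pow, Polynomial.aeval_X, Algebra.algebraMap_eq_smul_one,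
    smul_mul_assoc, one_mul, norm_smul, Real.norm_eq_abs]
  gcongr
  exact (norm_pow_le _ _).trans (by gcongr)

/-- The Leibniz rule raises the degree by one at the cost of one `O(1/n)` commutator, all other
factors being bounded uniformly in `n`. -/
theorem tendsto_commutator_aeval (hm : 0 < m) (H X : Matrix (Fin m) (Fin m) ℂ) (p : Polynomial ℝ) :
    Tendsto (fun n : ℕ => ‖Polynomial.aeval (meanField n X) p * meanField n H
      - meanField n H * Polynomial.aeval (meanField n X) p‖) atTop (𝓝 0) := by
  have : Nonempty (Fin m) := ⟨⟨0, hm⟩⟩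
  induction p using Polynomial.induction_on with
  | C a =>
    simp only [Polynomial.aeval_C]
    refine tendsto_const_nhds.congr fun n => ?_
    rw [Algebra.commutes, sub_self, norm_zero]
  | add p q hp hq =>
    refine squeeze_zero (fun n => norm_nonneg _) (fun n => ?_) (by simpa using hp.add hq)
    refine le_trans (le_of_eq ?_) (norm_add_le _ _)
    rw [map_add, add_mul, mul_add]
    congr 1
    abel
  | monomial k a ih =>
    have h0 : Tendsto (fun n : ℕ => (n : ℝ)⁻¹ * ‖X * H - H * X‖) atTop (𝓝 0) := by
      simpa using tendsto_inv_atTop_nhds_zero_nat.mul_const ‖X * H - H * X‖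
    have hc (n : ℕ) : ‖Polynomial.aeval (meanField n X) (Polynomial.C a * Polynomial.X ^ k)‖
        ≤ |a| * ‖X‖ ^ k := norm_aeval_monomial_le (norm_meanField_le X) a k
    have h1 := (ih.mul_const ‖X‖).add (h0.const_mul (|a| * ‖X‖ ^ k))
    rw [zero_mul, mul_zero, add_zero] at h1
    refine squeeze_zero (fun n => norm_nonneg _) (fun n => ?_) h1
    rw [pow_succ, ← mul_assoc, map_mul _ _ Polynomial.X, Polynomial.aeval_X]
    refine (norm_commutator_mul_le _ _ _).trans (add_le_add ?_ ?_)
    · exact mul_le_mul_of_nonneg_left (norm_meanField_le X) (norm_nonneg _)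
    · exact mul_le_mul (hc n) (norm_meanField_commutator_le X H) (norm_nonneg _)
        ((norm_nonneg _).trans (hc n))

/-- A continuous function of a mean-field observable asymptotically commutes with every other
mean-field observable. -/
theorem tendsto_commutator_cfc (hm : 0 < m) (H : Matrix (Fin m) (Fin m) ℂ)
    {X : Matrix (Fin m) (Fin m) ℂ} (hX : X.IsHermitian) {g : ℝ → ℝ}
    (hg : ContinuousOn g (Set.Icc (-‖X‖) ‖X‖)) :
    Tendsto (fun n : ℕ => ‖cfc g (meanField n X) * meanField n H
      - meanField n H * cfc g (meanField n X)‖) atTop (𝓝 0) := by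
  have : Nonempty (Fin m) := ⟨⟨0, hm⟩⟩
  rw [Metric.tendsto_atTop]
  intro ε hε
  -- Replacing `g` by a polynomial changes the commutator by at most `2 * η * ‖H‖ ≤ ε / 2`; the `+
  -- 1` covers `H = 0`.
  set η : ℝ := ε / (2 * (2 * ‖H‖ + 1)) with hη
  have hη0 : 0 < η := by positivity
  obtain ⟨p, hp⟩ := exists_polynomial_near_of_continuousOn _ _ g hg η hη0
  obtain ⟨N, hN⟩ := Metric.tendsto_atTop.1 (tendsto_commutator_aeval hm H X p) (ε / 2)
    (by positivity)
  refine ⟨N, fun n hn => ?_⟩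
  have h1 := hN n hn
  rw [Real.dist_0_eq_abs, abs_of_nonneg (norm_nonneg _)] at h1 ⊢
  have hXn := (isHermitian_meanField (n := n) hX).isSelfAdjoint
  set D := cfc g (meanField n X) - Polynomial.aeval (meanField n X) p with hD
  have hDn : ‖D‖ ≤ η := by
    rw [hD, ← cfc_polynomial p (meanField n X) hXn,
      ← cfc_sub g p.eval (meanField n X) (continuousOn_spectrum _) (continuousOn_spectrum _)]
    refine norm_cfc_le hη0.le fun x hx => ?_
    rw [Real.norm_eq_abs, abs_sub_comm]
    exact (hp x (spectrum_meanField_subset hm X hx)).le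
  have hid : cfc g (meanField n X) * meanField n H - meanField n H * cfc g (meanField n X)
      = (D * meanField n H - meanField n H * D)
        + (Polynomial.aeval (meanField n X) p * meanField n H
          - meanField n H * Polynomial.aeval (meanField n X) p) := by
    rw [hD]
    noncomm_ring
  have hHn := norm_meanField_le (n := n) H
  have h2 : ‖D * meanField n H‖ ≤ η * ‖H‖ := (norm_mul_le _ _).trans (by gcongr)
  have h3 : ‖meanField n H * D‖ ≤ ‖H‖ * η := (norm_mul_le _ _).trans (by gcongr)
  rw [hid]
  have h4 := norm_add_le (D * meanField n H - meanField n H * D)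
    (Polynomial.aeval (meanField n X) p * meanField n H
          - meanField n H * Polynomial.aeval (meanField n X) p)
  have h5 := norm_sub_le (D * meanField n H) (meanField n H * D)
  have h6 : η * (2 * ‖H‖ + 1) = ε / 2 := by
    rw [hη]
    field_simp
  nlinarith

theorem trace_exp_smul_one_add {ι : Type*} [Fintype ι] [DecidableEq ι] (r : ℝ)
    (A : Matrix ι ι ℂ) :
    (NormedSpace.exp (r • (1 : Matrix ι ι ℂ) + A)).trace.re
      = Real.exp r * (NormedSpace.exp A).trace.re := by
  have h1 : NormedSpace.exp (r • (1 : Matrix ι ι ℂ)) = Real.exp r • (1 : Matrix ι ι ℂ) := by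
    rw [exp_eq_cfc (A := r • (1 : Matrix ι ι ℂ))
      (IsSelfAdjoint.smul (IsSelfAdjoint.all r) (IsSelfAdjoint.one _)),
      ← Algebra.algebraMap_eq_smul_one, cfc_algebraMap, Algebra.algebraMap_eq_smul_one]
  rw [Matrix.exp_add_of_commute _ _ ((Commute.one_left A).smul_left r), h1, smul_mul_assoc,
    one_mul, Matrix.trace_smul, Complex.smul_re, smul_eq_mul]

theorem trace_exp_re_eq_exp_logTrExp {ι : Type*} [Fintype ι] [DecidableEq ι] [Nonempty ι]
    {A : Matrix ι ι ℂ} (hA : A.IsHermitian) :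
    (NormedSpace.exp A).trace.re = Real.exp (logTrExp A) := by
  rw [logTrExp, Real.exp_log (trace_exp_re_pos hA)]

theorem isHermitian_add_smul {ι : Type*} {H X : Matrix ι ι ℂ}
    (hH : H.IsHermitian) (hX : X.IsHermitian) (s : ℝ) : (-H + s • X).IsHermitian :=
  hH.neg.add (hX.smul (IsSelfAdjoint.all s))

theorem isHermitian_cfc {ι : Type*} [Fintype ι] [DecidableEq ι] (A : Matrix ι ι ℂ) (g : ℝ → ℝ) :
    (cfc g A).IsHermitian :=
  cfc_predicate g A

theorem isHermitian_smul_cfc_sub {H X : Matrix (Fin m) (Fin m) ℂ} (hH : H.IsHermitian)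
    (f : ℝ → ℝ) : ((n : ℝ) • (cfc f (meanField n X) - meanField n H)).IsHermitian :=
  ((isHermitian_cfc _ f).sub (isHermitian_meanField hH)).smul (IsSelfAdjoint.all _)

/-- Localisation with respect to a quadratic partition of unity in the spectrum of the mean-field
observable `X`. -/
theorem trace_exp_le_of_partition (hm : 0 < m) (hn : n ≠ 0) {H X : Matrix (Fin m) (Fin m) ℂ}
    (hH : H.IsHermitian) (hX : X.IsHermitian) {J : Type*} [Fintype J] (f : ℝ → ℝ)
    (g : J → ℝ → ℝ) (c s : J → ℝ)
    (hg1 : ∀ t ∈ Set.Icc (-‖X‖) ‖X‖, ∑ j, g j t * g j t = 1)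
    (hgf : ∀ j, ∀ t ∈ Set.Icc (-‖X‖) ‖X‖, f t * (g j t * g j t)
      ≤ (c j + s j * t) * (g j t * g j t)) :
    (NormedSpace.exp ((n : ℝ) • (cfc f (meanField n X) - meanField n H))).trace.re
      ≤ ∑ j, Real.exp (n * (c j + logTrExp (-H + s j • X)
        + ∑ i, ‖cfc (g i) (meanField n X) * meanField n H
          - meanField n H * cfc (g i) (meanField n X)‖)) := by
  have : Nonempty (Fin m) := ⟨⟨0, hm⟩⟩
  set Y := meanField n X with hY
  set K := meanField n H with hK
  have hYs : IsSelfAdjoint Y := (isHermitian_meanField hX).isSelfAdjoint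
  have hKs : IsSelfAdjoint K := (isHermitian_meanField hH).isSelfAdjoint
  have hspec : spectrum ℝ Y ⊆ Set.Icc (-‖X‖) ‖X‖ := spectrum_meanField_subset hm X
  set χ : J → Matrix (Fin n → Fin m) (Fin n → Fin m) ℂ := fun j => cfc (g j) Y with hχ
  set δ : ℝ := ∑ i, ‖χ i * K - K * χ i‖ with hδ
  have hχh (j : J) : (χ j).IsHermitian := isHermitian_cfc _ _
  have hχχ (h : J → ℝ → ℝ) : ∑ j, χ j * cfc (h j) Y * χ j
      = cfc (fun t => ∑ j, g j t * h j t * g j t) Y := by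
    have h0 := cfc_sum_univ (fun j t => g j t * h j t * g j t) Y
      (fun _ => continuousOn_spectrum _)
    have h1 : (∑ j, fun t => g j t * h j t * g j t) = fun t => ∑ j, g j t * h j t * g j t := by
      ext t
      simp
    rw [← h1, h0]
    refine Finset.sum_congr rfl fun j _ => ?_
    rw [cfc_mul _ _ Y (continuousOn_spectrum _) (continuousOn_spectrum _),
      cfc_mul _ _ Y (continuousOn_spectrum _) (continuousOn_spectrum _)]
  have hone : ∑ j, χ j * χ j = 1 := by
    have h1 := hχχ fun _ _ => 1
    simp only [cfc_const_one ℝ Y hYs, mul_one] at h1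
    rw [h1, ← cfc_const_one ℝ Y hYs]
    exact cfc_congr fun t ht => hg1 t (hspec ht)
  have hnorm (j : J) : ‖χ j‖ ≤ 1 := by
    refine norm_cfc_le zero_le_one fun t ht => ?_
    rw [Real.norm_eq_abs, ← sq_le_one_iff_abs_le_one, sq, ← hg1 t (hspec ht)]
    exact Finset.single_le_sum (f := fun i => g i t * g i t) (fun i _ => mul_self_nonneg _)
      (Finset.mem_univ j)
  have hF : cfc f Y ≤ ∑ j, χ j * (c j • 1 + s j • Y) * χ j := by
    have h1 (j : J) : c j • (1 : Matrix (Fin n → Fin m) (Fin n → Fin m) ℂ) + s j • Y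
        = cfc (fun t : ℝ => c j + s j * t) Y := by
      rw [cfc_const_add _ _ Y (continuousOn_spectrum _) hYs,
        cfc_const_mul_id _ Y hYs, Algebra.algebraMap_eq_smul_one]
    simp only [h1]
    rw [hχχ]
    refine cfc_mono (fun t ht => ?_) (continuousOn_spectrum _) (continuousOn_spectrum _)
    calc f t = ∑ j, f t * (g j t * g j t) := by rw [← Finset.mul_sum, hg1 t (hspec ht), mul_one]
      _ ≤ ∑ j, (c j + s j * t) * (g j t * g j t) :=
        Finset.sum_le_sum fun j _ => hgf j t (hspec ht)
      _ = _ := Finset.sum_congr rfl fun j _ => by ring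
  -- Localisation error: since the squares `χ j ^ 2` sum to 1, the difference is `∑ χ j [χ j, K]`,
  -- of norm at most `δ`.
  have hKE : ∑ j, χ j * K * χ j - δ • 1 ≤ K := by
    have h1 : K - ∑ j, χ j * K * χ j = ∑ j, χ j * (χ j * K - K * χ j) := by
      simp only [mul_sub, Finset.sum_sub_distrib, ← mul_assoc]
      rw [← Finset.sum_mul, hone, one_mul]
    have h2 : IsSelfAdjoint (K - ∑ j, χ j * K * χ j) := by
      refine hKs.sub (isSelfAdjoint_sum _ fun j _ => ?_)
      have := hKs.conjugate (χ j)
      rwa [(hχh j).isSelfAdjoint.star_eq] at this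
    have h3 : ‖K - ∑ j, χ j * K * χ j‖ ≤ δ := by
      rw [h1]
      refine (norm_sum_le _ _).trans (Finset.sum_le_sum fun j _ => ?_)
      refine (norm_mul_le _ _).trans ?_
      exact mul_le_of_le_one_left (norm_nonneg _) (hnorm j)
    have h4 := h2.neg_algebraMap_norm_le_self
    have h5 : algebraMap ℝ (Matrix (Fin n → Fin m) (Fin n → Fin m) ℂ)
        ‖K - ∑ j, χ j * K * χ j‖ ≤ algebraMap ℝ _ δ := algebraMap_mono _ h3
    rw [Algebra.algebraMap_eq_smul_one (R := ℝ) δ] at h5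
    have h6 := (neg_le_neg h5).trans h4
    rw [sub_le_iff_le_add]
    have h7 := add_le_add_left h6 (∑ j, χ j * K * χ j + δ • 1)
    convert h7 using 1 <;> abel
  -- The affine majorant on the `j`-th piece plus the localisation error: a scalar plus a sum of
  -- one-site operators, whose exponential has a factorised trace.
  set B : J → Matrix (Fin n → Fin m) (Fin n → Fin m) ℂ := fun j =>
    ((n : ℝ) * (c j + δ)) • 1 + ∑ k : Fin n, siteCopy n (-H + s j • X) k with hB
  have hBh (j : J) : (B j).IsHermitian :=
    (Matrix.isHermitian_one.smul (IsSelfAdjoint.all _)).add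
      (isHermitian_sum_siteCopy (isHermitian_add_smul hH hX _))
  have hBeq (j : J) : B j = (n : ℝ) • ((c j • 1 + s j • Y) - K + δ • 1) := by
    rw [hB]
    simp only
    rw [← smul_meanField hn, meanField_add, meanField_neg, meanField_smul, ← hY, ← hK]
    module
  have hA : (n : ℝ) • (cfc f Y - K) ≤ ∑ j, χ j * B j * χ j := by
    have h1 : ∑ j, χ j * B j * χ j = (n : ℝ) • ((∑ j, χ j * (c j • 1 + s j • Y) * χ j)
        - (∑ j, χ j * K * χ j - δ • 1)) := by
      have h2 : δ • (1 : Matrix (Fin n → Fin m) (Fin n → Fin m) ℂ) = ∑ j, χ j * (δ • 1) * χ j := by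
        simp only [mul_smul_comm, smul_mul_assoc, mul_one, ← Finset.smul_sum, hone]
      rw [h2, ← Finset.sum_sub_distrib, ← Finset.sum_sub_distrib, Finset.smul_sum]
      refine Finset.sum_congr rfl fun j _ => ?_
      rw [hBeq, mul_smul_comm, smul_mul_assoc]
      congr 1
      noncomm_ring
    rw [h1]
    exact smul_le_smul_of_nonneg_left (sub_le_sub hF hKE) (Nat.cast_nonneg n)
  refine (trace_exp_le_sum (isHermitian_smul_cfc_sub hH f) χ B hχh hBh hone hA).trans
    (le_of_eq (Finset.sum_congr rfl fun j _ => ?_))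
  rw [hB]
  simp only
  rw [trace_exp_smul_one_add, trace_exp_re_eq_exp_logTrExp
    (isHermitian_sum_siteCopy (isHermitian_add_smul hH hX _)),
    logTrExp_sum_siteCopy hm (isHermitian_add_smul hH hX _), ← Real.exp_add]
  congr 1
  ring

/-- A quadratic partition of unity subordinate to balls. -/
theorem exists_partition (S : Set ℝ) (T : Finset ℝ) (r : ℝ → ℝ)
    (hT : S ⊆ ⋃ u ∈ T, Metric.ball u (r u)) :
    ∃ g : T → ℝ → ℝ, (∀ j, ContinuousOn (g j) S) ∧ (∀ t ∈ S, ∑ j, g j t * g j t = 1) ∧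
      ∀ j t, g j t ≠ 0 → |t - j| < r j := by
  -- Tent functions on the balls, to be divided by the root of their sum of squares.
  set h : T → ℝ → ℝ := fun j t => max 0 (r j - |t - j|) with hh
  set q : ℝ → ℝ := fun t => ∑ j, h j t * h j t with hq
  have hcont (j : T) : Continuous (h j) := by fun_prop
  have hqpos (t : ℝ) (ht : t ∈ S) : 0 < q t := by
    obtain ⟨u, huT, hu⟩ := Set.mem_iUnion₂.1 (hT ht)
    refine Finset.sum_pos' (fun j _ => mul_self_nonneg _) ⟨⟨u, huT⟩, Finset.mem_univ _, ?_⟩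
    rw [Metric.mem_ball, Real.dist_eq] at hu
    have : 0 < h ⟨u, huT⟩ t := lt_max_of_lt_right (sub_pos.2 hu)
    positivity
  refine ⟨fun j t => h j t / √(q t), fun j => ?_, fun t ht => ?_, fun j t hne => ?_⟩
  · refine (hcont j).continuousOn.div ?_ fun t ht => (Real.sqrt_pos.2 (hqpos t ht)).ne'
    exact Continuous.continuousOn (by fun_prop)
  · have := hqpos t ht
    simp only [div_mul_div_comm, Real.mul_self_sqrt this.le]
    rw [← Finset.sum_div]
    exact div_self this.ne'
  · by_contra hlt
    refine hne ?_
    have : h j t = 0 := max_eq_left (by linarith [not_lt.1 hlt])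
    simp only [this, zero_div]

/-- The upper bound, by localisation on a finite cover of the spectral interval. -/
theorem eventually_lt_of_forall_lt (hm : 0 < m) {H X : Matrix (Fin m) (Fin m) ℂ}
    (hH : H.IsHermitian) (hX : X.IsHermitian) {f : ℝ → ℝ}
    (hf : ContinuousOn f (Set.Icc (-‖X‖) ‖X‖)) {V : ℝ}
    (hV : ∀ u ∈ Set.Icc (-‖X‖) ‖X‖, ∃ s : ℝ, f u - s * u + logTrExp (-H + s • X) < V) :
    ∀ ε > 0, ∀ᶠ n : ℕ in atTop, (1 / (n : ℝ)) *
      logTrExp ((n : ℝ) • (cfc f (meanField n X) - meanField n H)) < V + ε := by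
  have : Nonempty (Fin m) := ⟨⟨0, hm⟩⟩
  intro ε hε
  -- One quarter each for the oscillation of `f t - s u * t`, the commutators and the logarithm of
  -- the number of balls; the last is slack.
  have hε4 : 0 < ε / 4 := by positivity
  choose! s hs using hV
  have hr (u : ℝ) (hu : u ∈ Set.Icc (-‖X‖) ‖X‖) : ∃ r > 0, ∀ t ∈ Set.Icc (-‖X‖) ‖X‖,
      |t - u| < r → f t ≤ (f u - s u * u + ε / 4) + s u * t := by
    have hc : ContinuousOn (fun t => f t - s u * t) (Set.Icc (-‖X‖) ‖X‖) :=
      hf.sub (Continuous.continuousOn (by fun_prop))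
    obtain ⟨r, hr0, hr⟩ := Metric.continuousOn_iff.1 hc u hu (ε / 4) hε4
    refine ⟨r, hr0, fun t ht htu => ?_⟩
    have := (abs_lt.1 (hr t ht htu)).2
    linarith
  choose! r hr0 hr using hr
  obtain ⟨T, hTS, hT⟩ := (isCompact_Icc (a := -‖X‖) (b := ‖X‖)).elim_nhds_subcover
    (fun u => Metric.ball u (r u)) fun u hu => Metric.ball_mem_nhds u (hr0 u hu)
  obtain ⟨g, hgc, hg1, hgs⟩ := exists_partition _ T r hT
  have hδ : Tendsto (fun n : ℕ => ∑ j, ‖cfc (g j) (meanField n X) * meanField n H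
      - meanField n H * cfc (g j) (meanField n X)‖) atTop (𝓝 0) := by
    have := tendsto_finsetSum Finset.univ fun j (_ : j ∈ Finset.univ) =>
      tendsto_commutator_cfc hm H hX (hgc j)
    simpa using this
  have hlog : Tendsto (fun n : ℕ => (n : ℝ)⁻¹ * Real.log (Fintype.card T)) atTop (𝓝 0) := by
    simpa using tendsto_inv_atTop_nhds_zero_nat.mul_const (Real.log (Fintype.card T))
  filter_upwards [hδ.eventually (gt_mem_nhds hε4), hlog.eventually (gt_mem_nhds hε4),
    eventually_ne_atTop 0] with n h1 h2 hn
  set δ := ∑ j, ‖cfc (g j) (meanField n X) * meanField n H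
      - meanField n H * cfc (g j) (meanField n X)‖
  have hn0 : (0 : ℝ) < n := by exact_mod_cast Nat.pos_of_ne_zero hn
  have htr := trace_exp_le_of_partition hm hn hH hX f g
    (fun j => f j - s j * j + ε / 4) (fun j => s j) hg1 (fun j t ht => by
      by_cases h0 : g j t = 0
      · simp [h0]
      · exact mul_le_mul_of_nonneg_right (hr j (hTS j j.2) t ht (hgs j t h0)) (mul_self_nonneg _))
  have hle : (NormedSpace.exp ((n : ℝ) • (cfc f (meanField n X) - meanField n H))).trace.re
      ≤ Fintype.card T * Real.exp (n * (V + ε / 4 + δ)) := by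
    refine htr.trans ?_
    rw [← nsmul_eq_mul, ← Finset.card_univ, ← Finset.sum_const]
    refine Finset.sum_le_sum fun j _ => Real.exp_le_exp.2 ?_
    have := hs j (hTS j j.2)
    refine mul_le_mul_of_nonneg_left ?_ hn0.le
    linarith
  have hpos := trace_exp_re_pos (isHermitian_smul_cfc_sub (n := n) (X := X) hH f)
  have hcard : (Fintype.card T : ℝ) ≠ 0 := by
    intro h0
    rw [h0, zero_mul] at hle
    linarith
  have hlog := Real.log_le_log hpos hle
  rw [Real.log_mul hcard (Real.exp_pos _).ne', Real.log_exp] at hlog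
  calc (1 / (n : ℝ)) * logTrExp ((n : ℝ) • (cfc f (meanField n X) - meanField n H))
      ≤ (1 / (n : ℝ)) * (Real.log (Fintype.card T) + n * (V + ε / 4 + δ)) := by
        unfold logTrExp
        gcongr
    _ = (n : ℝ)⁻¹ * Real.log (Fintype.card T) + (V + ε / 4 + δ) := by field_simp
    _ < V + ε := by linarith

end UpperBound

/-! ### Tilted Gibbs states and the lower bound -/

section GibbsStates

open scoped MatrixOrder ComplexOrder Matrix

section

variable {ι : Type*} [Fintype ι] [DecidableEq ι]

theorem gibbs_sub (A M N : Matrix ι ι ℂ) : gibbs A (M - N) = gibbs A M - gibbs A N := by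
  simp only [gibbs, Matrix.mul_sub, Matrix.trace_sub, Complex.sub_re, sub_div]

theorem gibbs_smul (A M : Matrix ι ι ℂ) (r : ℝ) : gibbs A (r • M) = r * gibbs A M := by
  simp only [gibbs, Matrix.mul_smul, Matrix.trace_smul, Complex.smul_re, smul_eq_mul, mul_div_assoc]

theorem gibbs_one [Nonempty ι] {A : Matrix ι ι ℂ} (hA : A.IsHermitian) : gibbs A 1 = 1 := by
  rw [gibbs, Matrix.mul_one, div_self (trace_exp_re_pos hA).ne']

theorem gibbs_mono [Nonempty ι] {A M N : Matrix ι ι ℂ} (hA : A.IsHermitian) (h : M ≤ N) :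
    gibbs A M ≤ gibbs A N :=
  div_le_div_of_nonneg_right (re_trace_mul_mono (exp_nonneg hA) h) (trace_exp_re_pos hA).le

theorem gibbs_mem_Icc [Nonempty ι] {A X : Matrix ι ι ℂ} (hA : A.IsHermitian)
    (hX : X.IsHermitian) : gibbs A X ∈ Set.Icc (-‖X‖) ‖X‖ := by
  have h1 := gibbs_mono hA hX.isSelfAdjoint.le_algebraMap_norm_self
  have h2 := gibbs_mono hA hX.isSelfAdjoint.neg_algebraMap_norm_le_self
  rw [Algebra.algebraMap_eq_smul_one] at h1 h2
  rw [gibbs_smul, gibbs_one hA, mul_one] at h1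
  rw [← neg_smul, gibbs_smul, gibbs_one hA, mul_one] at h2
  exact ⟨h2, h1⟩

theorem continuous_exp_add_smul (H X : Matrix ι ι ℂ) :
    Continuous fun s : ℝ => NormedSpace.exp (-H + s • X) := by
  let _ : NormedAlgebra ℚ (Matrix ι ι ℂ) := .restrictScalars ℚ ℂ _
  exact NormedSpace.exp_continuous.comp (by fun_prop)

theorem continuous_gibbs [Nonempty ι] {H X : Matrix ι ι ℂ} (hH : H.IsHermitian)
    (hX : X.IsHermitian) : Continuous fun s : ℝ => gibbs (-H + s • X) X := by
  have h := continuous_exp_add_smul H X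
  refine Continuous.div (Complex.continuous_re.comp (h.mul continuous_const).matrix_trace)
    (Complex.continuous_re.comp h.matrix_trace) fun s => ?_
  exact (trace_exp_re_pos (isHermitian_add_smul hH hX s)).ne'

theorem continuous_logTrExp [Nonempty ι] {H X : Matrix ι ι ℂ} (hH : H.IsHermitian)
    (hX : X.IsHermitian) : Continuous fun s : ℝ => logTrExp (-H + s • X) :=
  (Complex.continuous_re.comp (continuous_exp_add_smul H X).matrix_trace).log fun s =>
    (trace_exp_re_pos (isHermitian_add_smul hH hX s)).ne'

end

variable {m : ℕ}

/-- The mean of `X` in the tilted Gibbs state is a subgradient of the cumulant function. -/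
theorem cumulant_add_le (hm : 0 < m) {H X : Matrix (Fin m) (Fin m) ℂ} (hH : H.IsHermitian)
    (hX : X.IsHermitian) (s t : ℝ) :
    cumulant H X s + (t - s) * gibbs (-H + s • X) X ≤ cumulant H X t := by
  have : Nonempty (Fin m) := ⟨⟨0, hm⟩⟩
  have h := logTrExp_add_gibbs_le (isHermitian_add_smul hH hX s) (isHermitian_add_smul hH hX t)
  have h1 : -H + t • X - (-H + s • X) = (t - s) • X := by module
  rw [h1, gibbs_smul] at h
  unfold cumulant
  linarith

theorem cumulant_zero (H X : Matrix (Fin m) (Fin m) ℂ) : cumulant H X 0 = 0 := by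
  simp [cumulant]

/-- Continuity suffices near `u`; at distance at least `r` the parabola absorbs the total
oscillation `2 * B`. The expectation of `f (X^(n))` is thereby controlled by a variance alone. -/
theorem exists_quadratic_minorant {f : ℝ → ℝ} {a b u : ℝ} (hf : ContinuousOn f (Set.Icc a b))
    (hu : u ∈ Set.Icc a b) {ε : ℝ} (hε : 0 < ε) :
    ∃ M : ℝ, ∀ t ∈ Set.Icc a b, f u - ε - M * ((t - u) * (t - u)) ≤ f t := by
  obtain ⟨B, hB⟩ := isCompact_Icc.exists_bound_of_continuousOn hf
  obtain ⟨r, hr0, hr⟩ := Metric.continuousOn_iff.1 hf u hu ε hε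
  have hB0 : 0 ≤ B := (norm_nonneg _).trans (hB u hu)
  refine ⟨2 * B / r ^ 2, fun t ht => ?_⟩
  have hM : 0 ≤ 2 * B / r ^ 2 * ((t - u) * (t - u)) :=
    mul_nonneg (by positivity) (mul_self_nonneg _)
  rcases lt_or_ge (dist t u) r with h | h
  · have := (abs_lt.1 (hr t ht h)).1
    linarith
  · have h1 : r ^ 2 ≤ (t - u) * (t - u) := by
      rw [← abs_mul_abs_self (t - u), sq]
      exact mul_self_le_mul_self hr0.le h
    have h2 : 2 * B ≤ 2 * B / r ^ 2 * ((t - u) * (t - u)) := by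
      rw [div_mul_eq_mul_div, le_div_iff₀ (by positivity)]
      gcongr
    have h3 := (abs_le.1 (hB u hu)).2
    have h4 := (abs_le.1 (hB t ht)).1
    linarith

/-- The Gibbs variational principle with product trial states, and the law of large numbers. -/
theorem eventually_gt_of_gibbs (hm : 0 < m) {H X : Matrix (Fin m) (Fin m) ℂ}
    (hH : H.IsHermitian) (hX : X.IsHermitian) {f : ℝ → ℝ}
    (hf : ContinuousOn f (Set.Icc (-‖X‖) ‖X‖)) (s : ℝ) {ε : ℝ} (hε : 0 < ε) :
    ∀ᶠ n : ℕ in atTop, logTrExp (-H + s • X) + f (gibbs (-H + s • X) X)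
        - s * gibbs (-H + s • X) X - ε
      < (1 / (n : ℝ)) * logTrExp ((n : ℝ) • (cfc f (meanField n X) - meanField n H)) := by
  have : Nonempty (Fin m) := ⟨⟨0, hm⟩⟩
  set K := -H + s • X with hKdef
  have hK : K.IsHermitian := isHermitian_add_smul hH hX s
  set u := gibbs K X with hu
  have huI : u ∈ Set.Icc (-‖X‖) ‖X‖ := gibbs_mem_Icc hK hX
  obtain ⟨M, hM⟩ := exists_quadratic_minorant hf huI (half_pos hε)
  set D := X - u • (1 : Matrix (Fin m) (Fin m) ℂ) with hD
  have hDh : D.IsHermitian := hX.sub (Matrix.isHermitian_one.smul (IsSelfAdjoint.all _))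
  have hD0 : gibbs K D = 0 := by
    rw [hD, gibbs_sub, gibbs_smul, gibbs_one hK, mul_one, ← hu, sub_self]
  have hlim : Tendsto (fun n : ℕ => M * ((n : ℝ)⁻¹ * gibbs K (D * D))) atTop (𝓝 0) := by
    simpa using (tendsto_inv_atTop_nhds_zero_nat.mul_const (gibbs K (D * D))).const_mul M
  filter_upwards [hlim.eventually (gt_mem_nhds (half_pos hε)), eventually_ne_atTop 0] with n h1 hn
  have hn0 : (0 : ℝ) < n := by exact_mod_cast Nat.pos_of_ne_zero hn
  set A := ∑ k : Fin n, siteCopy n K k with hA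
  have hAh : A.IsHermitian := isHermitian_sum_siteCopy hK
  set Y := meanField n X with hY
  have hYs : IsSelfAdjoint Y := (isHermitian_meanField hX).isSelfAdjoint
  have hDY : meanField n D = Y - u • 1 := by
    rw [hD, meanField_sub, meanField_smul, meanField_one hn]
  have hF : (f u - ε / 2) • 1 - M • (meanField n D * meanField n D) ≤ cfc f Y := by
    have h2 : meanField n D = cfc (fun t : ℝ => t - u) Y := by
      rw [hDY, cfc_sub _ _ Y (continuousOn_spectrum _) (continuousOn_spectrum _), cfc_id' ℝ Y hYs,
        cfc_const u Y hYs, Algebra.algebraMap_eq_smul_one]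
    have h3 : (f u - ε / 2) • 1 - M • (meanField n D * meanField n D)
        = cfc (fun t : ℝ => f u - ε / 2 - M * ((t - u) * (t - u))) Y := by
      rw [cfc_sub _ _ Y (continuousOn_spectrum _) (continuousOn_spectrum _), cfc_const _ Y hYs,
        cfc_const_mul _ _ Y (continuousOn_spectrum _),
        cfc_mul _ _ Y (continuousOn_spectrum _) (continuousOn_spectrum _), ← h2,
        Algebra.algebraMap_eq_smul_one]
    rw [h3]
    exact cfc_mono (fun t ht => hM t (spectrum_meanField_subset hm X ht))
      (continuousOn_spectrum _) (continuousOn_spectrum _)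
  have hgF := gibbs_mono hAh hF
  rw [gibbs_sub, gibbs_smul, gibbs_smul, gibbs_one hAh, mul_one,
    gibbs_sum_siteCopy_meanField_sq hm hn hK hDh hD0] at hgF
  -- The trial state is the product state; in the difference of exponents `H^(n)` cancels, leaving
  -- only functions of `X^(n)`.
  have hvar := logTrExp_add_gibbs_le hAh (isHermitian_smul_cfc_sub (n := n) (X := X) hH f)
  have hdiff : (n : ℝ) • (cfc f Y - meanField n H) - A = (n : ℝ) • (cfc f Y - s • Y) := by
    rw [hA, ← smul_meanField hn, hKdef, meanField_add, meanField_neg, meanField_smul, ← hY]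
    module
  rw [hdiff, gibbs_smul, gibbs_sub, gibbs_smul, hA, logTrExp_sum_siteCopy hm hK, ← hA, hY,
    gibbs_sum_siteCopy_meanField hm hn hK, ← hu, ← hY] at hvar
  rw [one_div, lt_inv_mul_iff₀ hn0]
  refine lt_of_lt_of_le ?_ hvar
  rw [← mul_add]
  refine mul_lt_mul_of_pos_left ?_ hn0
  linarith

/-- An approximate inverse of the subgradient of `C` at any point where the Legendre transform of
`C` is finite, by Tikhonov regularisation. -/
theorem exists_subgradient_eq {C w : ℝ → ℝ} (hC : Continuous C) (hw : Continuous w)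
    (hsub : ∀ s t, C s + (t - s) * w s ≤ C t) (h0 : C 0 = 0) {u v : ℝ}
    (hv : ∀ s, s * u - C s ≤ v) {δ : ℝ} (hδ : 0 < δ) :
    ∃ s, w s = u - δ * s ∧ δ * s ^ 2 / 2 ≤ v := by
  -- The bound `v` keeps `C s - s * u` above `-v`, so the quadratic term gives coercivity and hence
  -- a minimiser.
  have hlim : Tendsto (fun s => C s - s * u + δ * s ^ 2 / 2) (cocompact ℝ) atTop := by
    have h1 : Tendsto (fun s : ℝ => -v + δ / 2 * ‖s‖ ^ 2) (cocompact ℝ) atTop :=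
      tendsto_atTop_add_const_left _ _ (Tendsto.const_mul_atTop (half_pos hδ)
        ((tendsto_pow_atTop two_ne_zero).comp (tendsto_norm_cocompact_atTop)))
    refine tendsto_atTop_mono (fun s => ?_) h1
    have := hv s
    rw [Real.norm_eq_abs, sq_abs]
    linarith
  obtain ⟨s, hs⟩ := Continuous.exists_forall_le (by fun_prop) hlim
  -- Minimality at `s` combined with the subgradient inequality at `t`. Letting `t` tend to `s` from
  -- each side gives the stationarity equation without differentiating `C`.
  have hst (t : ℝ) : 0 ≤ (t - s) * (w t - u + δ * (t + s) / 2) := by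
    have h1 := hs t
    have h2 := hsub t s
    nlinarith
  have hcont : Tendsto (fun t => w t - u + δ * (t + s) / 2) (𝓝 s) (𝓝 (w s - u + δ * (s + s) / 2)) :=
    Continuous.tendsto (by fun_prop) s
  have hge : 0 ≤ w s - u + δ * (s + s) / 2 := by
    refine ge_of_tendsto (hcont.mono_left (nhdsWithin_le_nhds (s := Set.Ioi s))) ?_
    filter_upwards [self_mem_nhdsWithin] with t ht
    exact nonneg_of_mul_nonneg_right (hst t) (sub_pos.2 ht)
  have hle : w s - u + δ * (s + s) / 2 ≤ 0 := by
    refine le_of_tendsto (hcont.mono_left (nhdsWithin_le_nhds (s := Set.Iio s))) ?_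
    filter_upwards [self_mem_nhdsWithin] with t ht
    have h1 : t - s < 0 := sub_neg.2 ht
    nlinarith [hst t]
  refine ⟨s, by linarith, ?_⟩
  have h1 := hs 0
  have h2 := hv s
  rw [h0] at h1
  linarith

/-- The regularised tilt `s` has mean `u - δ * s`. Its squared distance to `u` is at most `2 * δ *
v`, so `f` barely changes, and the entropy cost does not exceed `v` because `s` times the mean is at
most `s * u`. -/
theorem eventually_gt_of_legendre_le (hm : 0 < m) {H X : Matrix (Fin m) (Fin m) ℂ}
    (hH : H.IsHermitian) (hX : X.IsHermitian) {f : ℝ → ℝ}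
    (hf : ContinuousOn f (Set.Icc (-‖X‖) ‖X‖)) {u v : ℝ} (hu : u ∈ Set.Icc (-‖X‖) ‖X‖)
    (hv : ∀ s, s * u - cumulant H X s ≤ v) {ε : ℝ} (hε : 0 < ε) :
    ∀ᶠ n : ℕ in atTop, f u - v + logTrExp (-H) - ε
      < (1 / (n : ℝ)) * logTrExp ((n : ℝ) • (cfc f (meanField n X) - meanField n H)) := by
  have : Nonempty (Fin m) := ⟨⟨0, hm⟩⟩
  have hv0 : 0 ≤ v := by simpa [cumulant_zero] using hv 0
  obtain ⟨r, hr0, hr⟩ := Metric.continuousOn_iff.1 hf u hu (ε / 2) (half_pos hε)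
  -- Chosen so that `2 * δ * v < r ^ 2`, also when `v = 0`.
  set δ : ℝ := r ^ 2 / (2 * v + 1) with hδ
  have hδ0 : 0 < δ := by positivity
  have hδv : δ * (2 * v) < r ^ 2 := by
    rw [hδ, div_mul_eq_mul_div, div_lt_iff₀ (by positivity)]
    nlinarith [pow_pos hr0 2]
  obtain ⟨s, hs, hsv⟩ := exists_subgradient_eq
    (((continuous_logTrExp hH hX).sub continuous_const : Continuous (cumulant H X)))
    (continuous_gibbs hH hX) (cumulant_add_le hm hH hX) (cumulant_zero H X) hv hδ0
  have hmem := gibbs_mem_Icc (isHermitian_add_smul hH hX s) hX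
  have hdist : dist (gibbs (-H + s • X) X) u < r := by
    rw [Real.dist_eq]
    refine abs_lt_of_sq_lt_sq ?_ hr0.le
    rw [hs]
    nlinarith
  have hfu := (abs_lt.1 (hr _ hmem hdist)).1
  filter_upwards [eventually_gt_of_gibbs hm hH hX hf s (half_pos hε)] with n h
  refine lt_of_le_of_lt ?_ h
  have h1 := hv s
  have h2 : s * gibbs (-H + s • X) X = s * u - δ * s ^ 2 := by rw [hs]; ring
  have h3 : 0 ≤ δ * s ^ 2 := by positivity
  unfold cumulant at h1
  linarith

end GibbsStates

/-! ### The rate function in the extended reals -/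

section RateFunction

variable {m : ℕ} {H X : Matrix (Fin m) (Fin m) ℂ}

theorem le_rate (H X : Matrix (Fin m) (Fin m) ℂ) (s u : ℝ) :
    ((s * u - cumulant H X s : ℝ) : EReal) ≤ rate H X u :=
  le_iSup (fun s : ℝ => ((s * u - cumulant H X s : ℝ) : EReal)) s

theorem rate_le_coe {u v : ℝ} (h : ∀ s, s * u - cumulant H X s ≤ v) : rate H X u ≤ (v : EReal) :=
  iSup_le fun s => EReal.coe_le_coe_iff.2 (h s)

theorem rate_nonneg (H X : Matrix (Fin m) (Fin m) ℂ) (u : ℝ) : 0 ≤ rate H X u := by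
  simpa [cumulant_zero] using le_rate H X 0 u

/-- Above, the rate is nonnegative and `f` is bounded; below, the rate vanishes at the mean of `X`
in the untilted Gibbs state. -/
theorem exists_coe_eq_iSup_sub_rate (hm : 0 < m) (hH : H.IsHermitian) (hX : X.IsHermitian)
    {f : ℝ → ℝ} (hf : ContinuousOn f (Set.Icc (-‖X‖) ‖X‖)) :
    ∃ L : ℝ, (L : EReal) = ⨆ u ∈ Set.Icc (-‖X‖) ‖X‖, ((f u : EReal) - rate H X u) := by
  have : Nonempty (Fin m) := ⟨⟨0, hm⟩⟩
  refine ⟨_, EReal.coe_toReal ?_ ?_⟩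
  · obtain ⟨B, hB⟩ := isCompact_Icc.exists_bound_of_continuousOn hf
    refine ne_top_of_le_ne_top (EReal.coe_ne_top B) (iSup₂_le fun u hu => ?_)
    calc (f u : EReal) - rate H X u ≤ (f u : EReal) - 0 :=
          EReal.sub_le_sub le_rfl (rate_nonneg H X u)
      _ = f u := sub_zero _
      _ ≤ B := EReal.coe_le_coe_iff.2 ((le_abs_self _).trans (hB u hu))
  · set u := gibbs (-H + (0 : ℝ) • X) X with hu
    have huI : u ∈ Set.Icc (-‖X‖) ‖X‖ := gibbs_mem_Icc (isHermitian_add_smul hH hX 0) hX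
    have hr : rate H X u ≤ ((0 : ℝ) : EReal) := rate_le_coe fun s => by
      have := cumulant_add_le hm hH hX 0 s
      rw [cumulant_zero, ← hu] at this
      linarith
    refine ne_bot_of_le_ne_bot (EReal.coe_ne_bot (f u)) ?_
    refine le_trans ?_ (le_iSup₂ (f := fun u (_ : u ∈ Set.Icc (-‖X‖) ‖X‖) =>
      (f u : EReal) - rate H X u) u huI)
    calc (f u : EReal) = (f u : EReal) - 0 := (sub_zero _).symm
      _ ≤ _ := EReal.sub_le_sub le_rfl hr

end RateFunction

end QLD

/-! ### The variational formula -/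

theorem theorem1 (m : ℕ) (hm : 0 < m) (H X : Matrix (Fin m) (Fin m) ℂ)
    (hH : H.IsHermitian) (hX : X.IsHermitian)
    (f : ℝ → ℝ) (hf : ContinuousOn f (Set.Icc (-‖X‖) ‖X‖)) :
    (∀ u ∈ Set.Icc (-‖X‖) ‖X‖, 0 ≤ QLD.rate H X u) ∧
    ∃ L : ℝ,
      (L : EReal) = (⨆ u ∈ Set.Icc (-‖X‖) ‖X‖, ((f u : EReal) - QLD.rate H X u)) ∧
      Tendsto
        (fun n : ℕ => (1 / (n : ℝ)) *
          QLD.logTrExp ((n : ℝ) • (cfc f (QLD.meanField n X) - QLD.meanField n H)))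
        atTop (𝓝 (L + QLD.logTrExp (-H))) := by
  refine ⟨fun u _ => QLD.rate_nonneg H X u, ?_⟩
  obtain ⟨L, hL⟩ := QLD.exists_coe_eq_iSup_sub_rate hm hH hX hf
  refine ⟨L, hL, ?_⟩
  rw [tendsto_order]
  constructor
  · intro a ha
    set ε := L + QLD.logTrExp (-H) - a with hε
    have hε0 : 0 < ε := sub_pos.2 ha
    have hlt : ((L - ε / 2 : ℝ) : EReal)
        < ⨆ u ∈ Set.Icc (-‖X‖) ‖X‖, ((f u : EReal) - QLD.rate H X u) := by
      rw [← hL, EReal.coe_lt_coe_iff]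
      linarith
    obtain ⟨u, hlt⟩ := lt_iSup_iff.1 hlt
    obtain ⟨hu, hlt⟩ := lt_iSup_iff.1 hlt
    -- A near-maximiser has finite rate, since an infinite one would contribute `⊥` to the supremum.
    have htop : QLD.rate H X u ≠ ⊤ := by
      intro h
      rw [h, EReal.sub_top] at hlt
      exact not_lt_bot hlt
    have hbot : QLD.rate H X u ≠ ⊥ :=
      ne_bot_of_le_ne_bot EReal.zero_ne_bot (QLD.rate_nonneg H X u)
    obtain ⟨v, hv⟩ : ∃ v : ℝ, (v : EReal) = QLD.rate H X u := ⟨_, EReal.coe_toReal htop hbot⟩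
    rw [← hv, ← EReal.coe_sub, EReal.coe_lt_coe_iff] at hlt
    have hs (s : ℝ) : s * u - QLD.cumulant H X s ≤ v := by
      have := QLD.le_rate H X s u
      rwa [← hv, EReal.coe_le_coe_iff] at this
    filter_upwards [QLD.eventually_gt_of_legendre_le hm hH hX hf hu hs (half_pos hε0)] with n hn
    refine lt_trans ?_ hn
    linarith
  · intro a ha
    set ε := a - (L + QLD.logTrExp (-H)) with hε
    have hε0 : 0 < ε := sub_pos.2 ha
    have hV (u : ℝ) (hu : u ∈ Set.Icc (-‖X‖) ‖X‖) : ∃ s : ℝ,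
        f u - s * u + QLD.logTrExp (-H + s • X) < L + QLD.logTrExp (-H) + ε / 2 := by
      -- If every slope failed, the rate at `u` would be at most `f u - L - ε / 2`, in particular
      -- finite, and `u` would beat the supremum `L`.
      by_contra! hcon
      have h1 : QLD.rate H X u ≤ ((f u - L - ε / 2 : ℝ) : EReal) := QLD.rate_le_coe fun s => by
        have := hcon s
        unfold QLD.cumulant
        linarith
      have h2 : (f u : EReal) - ((f u - L - ε / 2 : ℝ) : EReal) ≤ L := by
        refine (EReal.sub_le_sub le_rfl h1).trans ?_
        rw [hL]
        exact le_iSup₂ (f := fun u (_ : u ∈ Set.Icc (-‖X‖) ‖X‖) =>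
          (f u : EReal) - QLD.rate H X u) u hu
      rw [← EReal.coe_sub, EReal.coe_le_coe_iff] at h2
      linarith
    filter_upwards [QLD.eventually_lt_of_forall_lt hm hH hX hf hV (ε / 2) (half_pos hε0)]
      with n hn
    refine lt_of_lt_of_eq hn ?_
    rw [hε]
    ring
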